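/- An $L$-algebra is a set $X$ with a binary operation $(x,y)\mapsto x\cdot y$ and an element $1\in X$ such that for all $x,y,z\in X$: $x\cdot x=x\cdot 1=1$, $1\cdot x=x$, $(x\cdot y)\cdot(x\cdot z)=(y\cdot x)\cdot(y\cdot z)$, and $x\cdot y=y\cdot x=1$ implies $x=y$. An ideal of $X$ is a subset $I\subseteq X$ with $1\in I$ such that for all $x,y\in X$: if $x\in I$ and $x\cdot y\in I$, then $y\in I$; if $x\in I$, then $(x\cdot y)\cdot y$, $y\cdot x$ and $y\cdot(x\cdot y)$ belong to $I$. Let $\mathscr{I}(X)$ be the set of ideals of $X$, ordered by inclusion. For $I,J\in\mathscr{I}(X)$ put $I\cdot J=\{x\in X\mid \langle x\rangle\cap I\subseteq J\}$, where $\langle x\rangle$ is the ideal generated by $x$. An ideal $P\neq X$ is prime if for every ideal $I$ either $I\subseteq P$ or $I\cdot P\subseteq P$. The spectrum $\operatorname{Spec}X$ is the set of prime ideals of $X$, with the topology whose open sets are the sets $U_I=\{P\in\operatorname{Spec}X\mid I\not\subseteq P\}$, $I\in\mathscr{I}(X)$. Proposition 7. Let $X$ and $Y$ be $L$-algebras,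 and let $X\times Y$ be their product, with the componentwise operation. Then $(I,J)\mapsto I\times J$ is an isomorphism of partially ordered sets (hence of lattices) from $\mathscr{I}(X)\times\mathscr{I}(Y)$ onto $\mathscr{I}(X\times Y)$. Moreover, the map $\operatorname{Spec}X\sqcup\operatorname{Spec}Y\to\operatorname{Spec}(X\times Y)$ given by $P\mapsto P\times Y$ for $P\in\operatorname{Spec}X$ and $Q\mapsto X\times Q$ for $Q\in\operatorname{Spec}Y$ is a homeomorphism from the topological disjoint union onto $\operatorname{Spec}(X\times Y)$. -/

import Mathlib

universe u v

/-- An `L`-algebra: a set with a binary operation, written `x ⇨ y`, a logical unit `1`, and the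
laws below. No order is part of the data; `x ≤ y` would mean `x ⇨ y = 1`. -/
class LAlgebra (X : Type u) extends One X, HImp X where
  himp_self_eq_one : ∀ x : X, x ⇨ x = 1
  himp_one_eq_one : ∀ x : X, x ⇨ 1 = 1
  one_himp_eq : ∀ x : X, 1 ⇨ x = x
  himp_himp_himp : ∀ x y z : X, (x ⇨ y) ⇨ (x ⇨ z) = (y ⇨ x) ⇨ (y ⇨ z)
  eq_of_himp_eq_one : ∀ x y : X, x ⇨ y = 1 → y ⇨ x = 1 → x = y

/-- The product of two `L`-algebras: the cartesian product with the componentwise operation. -/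
instance instLAlgebraProd {X : Type u} {Y : Type v} [LAlgebra X] [LAlgebra Y] :
    LAlgebra (X × Y) where
  toOne := Prod.instOne
  toHImp := Prod.instHImp
  himp_self_eq_one a :=
    Prod.ext (LAlgebra.himp_self_eq_one a.1) (LAlgebra.himp_self_eq_one a.2)
  himp_one_eq_one a :=
    Prod.ext (LAlgebra.himp_one_eq_one a.1) (LAlgebra.himp_one_eq_one a.2)
  one_himp_eq a :=
    Prod.ext (LAlgebra.one_himp_eq a.1) (LAlgebra.one_himp_eq a.2)
  himp_himp_himp a b c :=
    Prod.ext (LAlgebra.himp_himp_himp a.1 b.1 c.1) (LAlgebra.himp_himp_himp a.2 b.2 c.2)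
  eq_of_himp_eq_one a b h k :=
    Prod.ext
      (LAlgebra.eq_of_himp_eq_one a.1 b.1 (congrArg Prod.fst h) (congrArg Prod.fst k))
      (LAlgebra.eq_of_himp_eq_one a.2 b.2 (congrArg Prod.snd h) (congrArg Prod.snd k))

/-- An ideal of an `L`-algebra. -/
structure LIdeal (X : Type u) [LAlgebra X] where
  carrier : Set X
  one_mem' : 1 ∈ carrier
  mp_mem' : ∀ x y : X, x ∈ carrier → x ⇨ y ∈ carrier → y ∈ carrier
  himp_himp_mem' : ∀ x y : X, x ∈ carrier → (x ⇨ y) ⇨ y ∈ carrier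
  himp_mem' : ∀ x y : X, x ∈ carrier → y ⇨ x ∈ carrier
  himp_himp_mem'' : ∀ x y : X, x ∈ carrier → y ⇨ (x ⇨ y) ∈ carrier

namespace LIdeal

instance instSetLike {X : Type u} [LAlgebra X] : SetLike (LIdeal X) X where
  coe := LIdeal.carrier
  coe_injective I J h := by
    cases I
    cases J
    congr

/-- Ideals are ordered by inclusion. -/
instance instPartialOrder {X : Type u} [LAlgebra X] : PartialOrder (LIdeal X) :=
  PartialOrder.ofSetLike (LIdeal X) X

/-- The intersection of a set of ideals. -/
instance instInfSet {X : Type u} [LAlgebra X] : InfSet (LIdeal X) where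
  sInf S :=
    { carrier := {x | ∀ I ∈ S, x ∈ I}
      one_mem' := fun I _ => I.one_mem'
      mp_mem' := fun x y hx hxy I hI => I.mp_mem' x y (hx I hI) (hxy I hI)
      himp_himp_mem' := fun x y hx I hI => I.himp_himp_mem' x y (hx I hI)
      himp_mem' := fun x y hx I hI => I.himp_mem' x y (hx I hI)
      himp_himp_mem'' := fun x y hx I hI => I.himp_himp_mem'' x y (hx I hI) }

/-- The complete lattice of ideals, with intersections as infima. -/
instance instCompleteLattice {X : Type u} [LAlgebra X] : CompleteLattice (LIdeal X) where
  __ := completeLatticeOfInf (LIdeal X) (fun _ =>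
    ⟨fun _ hI _ hx => hx _ hI, fun _ hJ _ hx I hI => hJ hI hx⟩)
  inf I J :=
    { carrier := {x | x ∈ I ∧ x ∈ J}
      one_mem' := ⟨I.one_mem', J.one_mem'⟩
      mp_mem' := fun x y hx hxy => ⟨I.mp_mem' x y hx.1 hxy.1, J.mp_mem' x y hx.2 hxy.2⟩
      himp_himp_mem' := fun x y hx => ⟨I.himp_himp_mem' x y hx.1, J.himp_himp_mem' x y hx.2⟩
      himp_mem' := fun x y hx => ⟨I.himp_mem' x y hx.1, J.himp_mem' x y hx.2⟩
      himp_himp_mem'' := fun x y hx =>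
        ⟨I.himp_himp_mem'' x y hx.1, J.himp_himp_mem'' x y hx.2⟩ }
  inf_le_left _ _ _ hx := hx.1
  inf_le_right _ _ _ hx := hx.2
  le_inf _ _ _ h k _ hx := ⟨h hx, k hx⟩
  top :=
    { carrier := Set.univ
      one_mem' := trivial
      mp_mem' := fun _ _ _ _ => trivial
      himp_himp_mem' := fun _ _ _ => trivial
      himp_mem' := fun _ _ _ => trivial
      himp_himp_mem'' := fun _ _ _ => trivial }
  le_top _ _ _ := trivial

/-- The ideal generated by an element. -/
def span {X : Type u} [LAlgebra X] (x : X) : LIdeal X :=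
  sInf {I | x ∈ I}

/-- The operation `I · J = {x | ⟨x⟩ ∩ I ⊆ J}` on ideals, given as a subset of `X`. -/
def residual {X : Type u} [LAlgebra X] (I J : LIdeal X) : Set X :=
  {x | ((span x : LIdeal X) : Set X) ∩ (I : Set X) ⊆ (J : Set X)}

/-- Prime ideals: proper ideals `P` such that `I ⊆ P` or `I · P ⊆ P` for every ideal `I`. -/
def IsPrime {X : Type u} [LAlgebra X] (P : LIdeal X) : Prop :=
  (P : Set X) ≠ Set.univ ∧
    ∀ I : LIdeal X, (I : Set X) ⊆ (P : Set X) ∨ residual I P ⊆ (P : Set X)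

theorem IsPrime.le_or_le {X : Type u} [LAlgebra X] {P : LIdeal X} (hP : P.IsPrime)
    {I J : LIdeal X} (h : I ⊓ J ≤ P) : I ≤ P ∨ J ≤ P := by
  rcases hP.2 I with hI | hI
  · exact Or.inl hI
  · refine Or.inr fun x hx => hI fun z hz => h ⟨hz.2, ?_⟩
    exact hz.1 J hx

end LIdeal

/-- The spectrum of an `L`-algebra: the set of its prime ideals. -/
def LSpec (X : Type u) [LAlgebra X] : Type u :=
  {P : LIdeal X // P.IsPrime}

namespace LSpec

/-- The set `U_I` of prime ideals that do not contain the ideal `I`. -/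
def basicOpen {X : Type u} [LAlgebra X] (I : LIdeal X) : Set (LSpec X) :=
  {P | ¬ I ≤ P.1}

/-- The topology of the spectrum: the open sets are the sets `U_I`. -/
instance instTopologicalSpace {X : Type u} [LAlgebra X] : TopologicalSpace (LSpec X) where
  IsOpen U := ∃ I : LIdeal X, U = basicOpen I
  isOpen_univ := by
    refine ⟨⊤, (Set.eq_univ_of_forall fun P h => P.2.1 ?_).symm⟩
    exact Set.eq_univ_of_forall fun x => h (show x ∈ (⊤ : LIdeal X) from trivial)
  isOpen_inter := by
    rintro _ _ ⟨I, rfl⟩ ⟨J, rfl⟩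
    refine ⟨I ⊓ J, Set.ext fun P => ⟨fun h k => ?_, fun h => ⟨fun k => ?_, fun k => ?_⟩⟩⟩
    · exact (P.2.le_or_le k).elim h.1 h.2
    · exact h (inf_le_left.trans k)
    · exact h (inf_le_right.trans k)
  isOpen_sUnion := by
    intro S hS
    refine ⟨sSup {I | basicOpen I ∈ S}, Set.ext fun P => ⟨?_, fun h => ?_⟩⟩
    · rintro ⟨U, hU, hP⟩ k
      obtain ⟨I, rfl⟩ := hS U hU
      exact hP ((le_sSup (show I ∈ {I | basicOpen I ∈ S} from hU)).trans k)
    · by_contra hn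
      refine h (sSup_le fun I hI => ?_)
      by_contra hle
      exact hn ⟨basicOpen I, hI, hle⟩

end LSpec

/-! Every ideal `K` of the product is a product of ideals, because the unit lets implication isolate
coordinates: `(1, y) ⇨ (x, y) = (x, 1)` and `(x, 1) ⇨ (x, y) = (1, y)`. So `K` is determined by its
slices through `1` (`mk_mem_iff`), which gives the lattice isomorphism. Intersections, generated
ideals and residuals are then computed factorwise (`residual_prod`), so `P × Y` is prime exactly
when `P` is, and symmetrically. A prime of the product contains `⊤ × ⊥` or `⊥ × ⊤`, since these meet
in the bottom ideal; hence one of its factors is everything. Finally `U_{I × J}` pulls back to the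
disjoint union of `U_I` and `U_J`, so the bijection of spectra matches open sets. -/

namespace LIdeal

section Prod

variable {X : Type u} {Y : Type v} [LAlgebra X] [LAlgebra Y]

/-- The product of two ideals, an ideal of the product algebra. -/
def prod (I : LIdeal X) (J : LIdeal Y) : LIdeal (X × Y) where
  carrier := (I : Set X) ×ˢ (J : Set Y)
  one_mem' := ⟨I.one_mem', J.one_mem'⟩
  mp_mem' a b ha hab := ⟨I.mp_mem' a.1 b.1 ha.1 hab.1, J.mp_mem' a.2 b.2 ha.2 hab.2⟩
  himp_himp_mem' a b ha := ⟨I.himp_himp_mem' a.1 b.1 ha.1, J.himp_himp_mem' a.2 b.2 ha.2⟩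
  himp_mem' a b ha := ⟨I.himp_mem' a.1 b.1 ha.1, J.himp_mem' a.2 b.2 ha.2⟩
  himp_himp_mem'' a b ha := ⟨I.himp_himp_mem'' a.1 b.1 ha.1, J.himp_himp_mem'' a.2 b.2 ha.2⟩

theorem prod_le_prod {I I' : LIdeal X} {J J' : LIdeal Y} :
    prod I J ≤ prod I' J' ↔ I ≤ I' ∧ J ≤ J' := by
  refine ⟨fun h => ⟨fun x hx => ?_, fun y hy => ?_⟩, fun h a ha => ⟨h.1 ha.1, h.2 ha.2⟩⟩
  · exact (h (show (x, (1 : Y)) ∈ prod I J from ⟨hx, J.one_mem'⟩)).1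
  · exact (h (show ((1 : X), y) ∈ prod I J from ⟨I.one_mem', hy⟩)).2

/-- The trace of an ideal of the product on the first factor. -/
def fstTrace (K : LIdeal (X × Y)) : LIdeal X where
  carrier := {x | (x, 1) ∈ K}
  one_mem' := K.one_mem'
  mp_mem' x y hx hxy := K.mp_mem' (x, 1) (y, 1) hx <| by
    have e : ((x, 1) : X × Y) ⇨ (y, 1) = (x ⇨ y, 1) :=
      Prod.ext rfl (LAlgebra.himp_self_eq_one 1)
    rw [e]; exact hxy
  himp_himp_mem' x y hx := by
    have e : (((x, 1) : X × Y) ⇨ (y, 1)) ⇨ (y, 1) = ((x ⇨ y) ⇨ y, 1) :=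
      Prod.ext rfl (LAlgebra.himp_one_eq_one _)
    have h := K.himp_himp_mem' (x, 1) (y, 1) hx
    rwa [e] at h
  himp_mem' x y hx := by
    have e : ((y, 1) : X × Y) ⇨ (x, 1) = (y ⇨ x, 1) :=
      Prod.ext rfl (LAlgebra.himp_self_eq_one 1)
    have h := K.himp_mem' (x, 1) (y, 1) hx
    rwa [e] at h
  himp_himp_mem'' x y hx := by
    have e : ((y, 1) : X × Y) ⇨ ((x, 1) ⇨ (y, 1)) = (y ⇨ (x ⇨ y), 1) :=
      Prod.ext rfl (LAlgebra.one_himp_eq _ |>.trans (LAlgebra.himp_self_eq_one 1))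
    have h := K.himp_himp_mem'' (x, 1) (y, 1) hx
    rwa [e] at h

/-- The trace of an ideal of the product on the second factor. -/
def sndTrace (K : LIdeal (X × Y)) : LIdeal Y where
  carrier := {y | (1, y) ∈ K}
  one_mem' := K.one_mem'
  mp_mem' x y hx hxy := K.mp_mem' (1, x) (1, y) hx <| by
    have e : ((1, x) : X × Y) ⇨ (1, y) = (1, x ⇨ y) :=
      Prod.ext (LAlgebra.himp_self_eq_one 1) rfl
    rw [e]; exact hxy
  himp_himp_mem' x y hx := by
    have e : (((1, x) : X × Y) ⇨ (1, y)) ⇨ (1, y) = (1, (x ⇨ y) ⇨ y) :=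
      Prod.ext (LAlgebra.himp_one_eq_one _) rfl
    have h := K.himp_himp_mem' (1, x) (1, y) hx
    rwa [e] at h
  himp_mem' x y hx := by
    have e : ((1, y) : X × Y) ⇨ (1, x) = (1, y ⇨ x) :=
      Prod.ext (LAlgebra.himp_self_eq_one 1) rfl
    have h := K.himp_mem' (1, x) (1, y) hx
    rwa [e] at h
  himp_himp_mem'' x y hx := by
    have e : ((1, y) : X × Y) ⇨ ((1, x) ⇨ (1, y)) = (1, y ⇨ (x ⇨ y)) :=
      Prod.ext (LAlgebra.one_himp_eq _ |>.trans (LAlgebra.himp_self_eq_one 1)) rfl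
    have h := K.himp_himp_mem'' (1, x) (1, y) hx
    rwa [e] at h

/-- Closure under `y ⇨ x` extracts each coordinate; modus ponens from `(x, 1)` reassembles the pair.
-/
theorem mk_mem_iff {K : LIdeal (X × Y)} {x : X} {y : Y} :
    (x, y) ∈ K ↔ (x, 1) ∈ K ∧ (1, y) ∈ K := by
  refine ⟨fun h => ⟨?_, ?_⟩, fun h => K.mp_mem' (x, 1) (x, y) h.1 ?_⟩
  · have e : ((1, y) : X × Y) ⇨ (x, y) = (x, 1) :=
      Prod.ext (LAlgebra.one_himp_eq x) (LAlgebra.himp_self_eq_one y)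
    rw [← e]; exact K.himp_mem' _ _ h
  · have e : ((x, 1) : X × Y) ⇨ (x, y) = (1, y) :=
      Prod.ext (LAlgebra.himp_self_eq_one x) (LAlgebra.one_himp_eq y)
    rw [← e]; exact K.himp_mem' _ _ h
  · have e : ((x, 1) : X × Y) ⇨ (x, y) = (1, y) :=
      Prod.ext (LAlgebra.himp_self_eq_one x) (LAlgebra.one_himp_eq y)
    rw [e]; exact h.2

theorem prod_trace (K : LIdeal (X × Y)) : prod (fstTrace K) (sndTrace K) = K :=
  SetLike.ext fun _ => mk_mem_iff.symm

theorem fstTrace_prod (I : LIdeal X) (J : LIdeal Y) : fstTrace (prod I J) = I :=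
  SetLike.ext fun x => and_iff_left (a := x ∈ I) J.one_mem'

theorem sndTrace_prod (I : LIdeal X) (J : LIdeal Y) : sndTrace (prod I J) = J :=
  SetLike.ext fun y => and_iff_right (b := y ∈ J) I.one_mem'

/-- The ideals of a product are the products of ideals. -/
def prodOrderIso : LIdeal X × LIdeal Y ≃o LIdeal (X × Y) where
  toFun p := prod p.1 p.2
  invFun K := (fstTrace K, sndTrace K)
  left_inv p := Prod.ext (fstTrace_prod p.1 p.2) (sndTrace_prod p.1 p.2)
  right_inv := prod_trace
  map_rel_iff' := prod_le_prod

/-! ### Generated ideals, residuals and primes of the product -/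

theorem mem_span_self {X : Type u} [LAlgebra X] (x : X) : x ∈ span x :=
  fun _ hI => hI

theorem span_le_iff {X : Type u} [LAlgebra X] {x : X} {I : LIdeal X} : span x ≤ I ↔ x ∈ I :=
  ⟨fun h => h (mem_span_self x), fun h => sInf_le h⟩

theorem span_mk (x : X) (y : Y) : span (x, y) = prod (span x) (span y) := by
  refine le_antisymm (span_le_iff.2 ⟨mem_span_self x, mem_span_self y⟩) ?_
  -- As `span (x, y)` is itself a product of ideals, its factors contain `x` and `y`, hence the
  -- ideals these generate.
  have h : (x, y) ∈ prod (fstTrace (span (x, y))) (sndTrace (span (x, y))) := by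
    rw [prod_trace]; exact mem_span_self _
  rw [← prod_trace (span (x, y))]
  exact prod_le_prod.2 ⟨span_le_iff.2 h.1, span_le_iff.2 h.2⟩

theorem mem_residual {X : Type u} [LAlgebra X] {I J : LIdeal X} {x : X} :
    x ∈ residual I J ↔ span x ⊓ I ≤ J :=
  Iff.rfl

theorem prod_inf_prod (I I' : LIdeal X) (J J' : LIdeal Y) :
    prod I J ⊓ prod I' J' = prod (I ⊓ I') (J ⊓ J') :=
  (map_inf prodOrderIso (I, J) (I', J')).symm

theorem residual_prod (I I' : LIdeal X) (J J' : LIdeal Y) :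
    residual (prod I J) (prod I' J') = residual I I' ×ˢ residual J J' := by
  ext ⟨x, y⟩
  rw [Set.mem_prod, mem_residual, mem_residual, mem_residual, span_mk, prod_inf_prod,
    prod_le_prod]

theorem coe_eq_univ_iff {X : Type u} [LAlgebra X] {I : LIdeal X} :
    (I : Set X) = Set.univ ↔ I = ⊤ :=
  (SetLike.coe_injective.eq_iff (a := I) (b := ⊤))

theorem one_mem_residual {X : Type u} [LAlgebra X] (I J : LIdeal X) : 1 ∈ residual I J :=
  mem_residual.2 (inf_le_left.trans (span_le_iff.2 J.one_mem'))

theorem prod_top_top : prod (⊤ : LIdeal X) (⊤ : LIdeal Y) = ⊤ :=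
  map_top (prodOrderIso (X := X) (Y := Y))

theorem prod_inj {I I' : LIdeal X} {J J' : LIdeal Y} :
    prod I J = prod I' J' ↔ I = I' ∧ J = J' :=
  (prodOrderIso.injective.eq_iff (a := (I, J)) (b := (I', J'))).trans Prod.mk_inj

/-- Ideals `I × Y` test the primality of `P`. Conversely, on the `Y` side both alternatives hold
trivially, so only the `X` trace of `K` matters. -/
theorem isPrime_prod_top {P : LIdeal X} : (prod P (⊤ : LIdeal Y)).IsPrime ↔ P.IsPrime := by
  refine and_congr (not_congr ?_) ⟨fun h I => ?_, fun h K => ?_⟩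
  · rw [coe_eq_univ_iff, coe_eq_univ_iff, ← prod_top_top, prod_inj, and_iff_left rfl]
  · refine (h (prod I ⊤)).imp (fun hI => (prod_le_prod.1 hI).1) fun hI x hx => ?_
    rw [residual_prod] at hI
    exact (hI (show (x, (1 : Y)) ∈ _ from ⟨hx, one_mem_residual _ _⟩)).1
  · rw [← prod_trace K, residual_prod]
    exact (h (fstTrace K)).imp (fun hI => prod_le_prod.2 ⟨hI, le_top⟩)
      fun hI _ ha => ⟨hI ha.1, trivial⟩

theorem isPrime_top_prod {Q : LIdeal Y} : (prod (⊤ : LIdeal X) Q).IsPrime ↔ Q.IsPrime := by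
  refine and_congr (not_congr ?_) ⟨fun h J => ?_, fun h K => ?_⟩
  · rw [coe_eq_univ_iff, coe_eq_univ_iff, ← prod_top_top, prod_inj, and_iff_right rfl]
  · refine (h (prod ⊤ J)).imp (fun hJ => (prod_le_prod.1 hJ).2) fun hJ y hy => ?_
    rw [residual_prod] at hJ
    exact (hJ (show ((1 : X), y) ∈ _ from ⟨one_mem_residual _ _, hy⟩)).2
  · rw [← prod_trace K, residual_prod]
    exact (h (sndTrace K)).imp (fun hJ => prod_le_prod.2 ⟨le_top, hJ⟩)
      fun hJ _ ha => ⟨trivial, hJ ha.2⟩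

theorem IsPrime.ne_top {X : Type u} [LAlgebra X] {P : LIdeal X} (hP : P.IsPrime) : P ≠ ⊤ :=
  fun h => hP.1 (coe_eq_univ_iff.2 h)

theorem IsPrime.eq_top_or_eq_top {I : LIdeal X} {J : LIdeal Y} (h : (prod I J).IsPrime) :
    I = ⊤ ∨ J = ⊤ := by
  have hle : prod (⊤ : LIdeal X) (⊥ : LIdeal Y) ⊓ prod ⊥ ⊤ ≤ prod I J := by
    rw [prod_inf_prod, inf_bot_eq, bot_inf_eq]
    exact prod_le_prod.2 ⟨bot_le, bot_le⟩
  exact (h.le_or_le hle).imp (fun h => top_le_iff.1 (prod_le_prod.1 h).1)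
    fun h => top_le_iff.1 (prod_le_prod.1 h).2

end Prod

end LIdeal

/-! ### The homeomorphism of spectra -/

namespace LSpec

open LIdeal

variable {X : Type u} {Y : Type v} [LAlgebra X] [LAlgebra Y]

/-- The map from the disjoint union of the spectra to the spectrum of the product. -/
def sumToProd : LSpec X ⊕ LSpec Y → LSpec (X × Y) :=
  Sum.elim (fun P => ⟨prod P.1 ⊤, isPrime_prod_top.2 P.2⟩)
    (fun Q => ⟨prod ⊤ Q.1, isPrime_top_prod.2 Q.2⟩)

theorem sumToProd_injective : Function.Injective (sumToProd (X := X) (Y := Y)) := by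
  -- In the mixed cases, comparing factors would make a prime equal to `⊤`.
  rintro (P | P) (Q | Q) h <;> have h' := prod_inj.1 (congrArg Subtype.val h)
  · exact congrArg Sum.inl (Subtype.ext h'.1)
  · exact absurd h'.1 P.2.ne_top
  · exact absurd h'.2 P.2.ne_top
  · exact congrArg Sum.inr (Subtype.ext h'.2)

theorem sumToProd_surjective : Function.Surjective (sumToProd (X := X) (Y := Y)) := by
  rintro ⟨K, hK⟩
  obtain ⟨⟨I, J⟩, rfl⟩ := prodOrderIso.surjective K
  rcases IsPrime.eq_top_or_eq_top hK with h | h <;> dsimp only at h <;> subst h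
  · exact ⟨Sum.inr ⟨J, isPrime_top_prod.1 hK⟩, rfl⟩
  · exact ⟨Sum.inl ⟨I, isPrime_prod_top.1 hK⟩, rfl⟩

theorem sumToProd_inl_mem_basicOpen {P : LSpec X} {I : LIdeal X} {J : LIdeal Y} :
    sumToProd (Sum.inl P) ∈ basicOpen (prod I J) ↔ P ∈ basicOpen I :=
  not_congr (prod_le_prod.trans (and_iff_left le_top))

theorem sumToProd_inr_mem_basicOpen {Q : LSpec Y} {I : LIdeal X} {J : LIdeal Y} :
    sumToProd (Sum.inr Q) ∈ basicOpen (prod I J) ↔ Q ∈ basicOpen J :=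
  not_congr (prod_le_prod.trans (and_iff_right le_top))

theorem isOpen_preimage_sumToProd {S : Set (LSpec (X × Y))} :
    IsOpen (sumToProd ⁻¹' S) ↔ IsOpen S := by
  rw [isOpen_sum_iff]
  constructor
  · rintro ⟨⟨I, hI⟩, ⟨J, hJ⟩⟩
    -- Every open set is a single `U_I`, so one ideal from each spectrum suffices.
    refine ⟨prod I J, Set.ext fun R => ?_⟩
    obtain ⟨P | Q, rfl⟩ := sumToProd_surjective R
    · exact (Set.ext_iff.1 hI P).trans sumToProd_inl_mem_basicOpen.symm
    · exact (Set.ext_iff.1 hJ Q).trans sumToProd_inr_mem_basicOpen.symm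
  · rintro ⟨K, rfl⟩
    obtain ⟨⟨I, J⟩, rfl⟩ := prodOrderIso.surjective K
    exact ⟨⟨I, Set.ext fun P => sumToProd_inl_mem_basicOpen⟩,
      ⟨J, Set.ext fun Q => sumToProd_inr_mem_basicOpen⟩⟩

/-- The spectrum of a product is the disjoint union of the spectra of the factors. -/
noncomputable def sumHomeomorphProd : LSpec X ⊕ LSpec Y ≃ₜ LSpec (X × Y) :=
  (Equiv.ofBijective sumToProd ⟨sumToProd_injective, sumToProd_surjective⟩).toHomeomorph
    fun _ => isOpen_preimage_sumToProd

end LSpec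

theorem proposition7 {X : Type u} {Y : Type v} [LAlgebra X] [LAlgebra Y] :
    (∃ e : LIdeal X × LIdeal Y ≃o LIdeal (X × Y),
      ∀ (I : LIdeal X) (J : LIdeal Y),
        (e (I, J) : Set (X × Y)) = (I : Set X) ×ˢ (J : Set Y)) ∧
    (∃ s : LSpec X ⊕ LSpec Y ≃ₜ LSpec (X × Y),
      (∀ P : LSpec X,
        ((s (Sum.inl P)).1 : Set (X × Y)) = (P.1 : Set X) ×ˢ (Set.univ : Set Y)) ∧
      (∀ Q : LSpec Y,
        ((s (Sum.inr Q)).1 : Set (X × Y)) = (Set.univ : Set X) ×ˢ (Q.1 : Set Y))) :=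
  ⟨⟨LIdeal.prodOrderIso, fun _ _ => rfl⟩,
    ⟨LSpec.sumHomeomorphProd, fun _ => rfl, fun _ => rfl⟩⟩
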